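/- Let $n \ge 1$. For a vector of link lengths $L=(l_1,\dots,l_n)\in\mathbb{R}^n_+$ (all $l_i>0$), let $M^0(L)$ be the moduli space of the planar robot arm $L$, that is, the set of all $(n+1)$-tuples $R=(r_0,\dots,r_n)$ of points of the Euclidean plane $\mathbb{R}^2$ with $|r_{i-1}r_i|=l_i$ for $i=1,\dots,n$, $r_0=(0,0)$ and $r_1=(l_1,0)$. It is an $(n-1)$-dimensional torus, with smooth structure given by the angle coordinates $\beta_k$ (the angle from $r_0r_1$ to $r_kr_{k+1}$, modulo $2\pi$), $k=1,\dots,n-1$. The oriented area $A(R)$ of $R$ with vertices $r_i=(x_i,y_i)$ is defined by $$2A(R)=(x_0y_1-x_1y_0)+\dots+(x_{n-1}y_n-x_ny_{n-1})+(x_ny_0-x_0y_n).$$ Then for a generic $L\in\mathbb{R}^n_+$ the function $A$ is a Morse function on $M^0(L)$: it is smooth, and every critical point of $A$ on $M^0(L)$ is nondegenerate, i.e. the Hessian of $A$ at this point is a nondegenerate bilinear form. Here generic means that the set of all $L\in\mathbb{R}^n_+$ with this property is open and dense in $\mathbb{R}^n_+$, and that its complement in $\mathbb{R}^n_+$ has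 Lebesgue measure zero. -/

import Mathlib

open scoped ContDiff

/-- The Euclidean plane. -/
abbrev Plane : Type := EuclideanSpace ℝ (Fin 2)

/-- `ℝⁿ₊` with `n = m + 1`: vectors of (strictly positive) link lengths. -/
def lengthVectors (m : ℕ) : Set (Fin (m + 1) → ℝ) := {L | ∀ i, 0 < L i}

/-- `R = (r₀, …, rₙ)` is a configuration of the robot arm `L = (l₁, …, lₙ)`:
consecutive vertices have distances `l₁, …, lₙ`. Here `n = m + 1`, and `L i` is the length
of the link from `R i.castSucc` to `R i.succ`. -/
def IsConfiguration {m : ℕ} (L : Fin (m + 1) → ℝ) (R : Fin (m + 2) → Plane) : Prop :=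
  ∀ i : Fin (m + 1), dist (R i.castSucc) (R i.succ) = L i

/-- The moduli space `M⁰(L)`: configurations with `r₀ = (0, 0)` and `r₁ = (l₁, 0)`. -/
def moduliSpace {m : ℕ} (L : Fin (m + 1) → ℝ) : Set (Fin (m + 2) → Plane) :=
  {R | IsConfiguration L R ∧ R 0 = !₂[0, 0] ∧ R 1 = !₂[L 0, 0]}

/-- The oriented area
`A(R) = ((x₀ y₁ - x₁ y₀) + ⋯ + (xₙ₋₁ yₙ - xₙ yₙ₋₁) + (xₙ y₀ - x₀ yₙ)) / 2`.
The addition in `k + 1` is cyclic, so that the vertex after the last one is the first one. -/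
noncomputable def orientedArea {m : ℕ} (R : Fin (m + 2) → Plane) : ℝ :=
  (∑ k : Fin (m + 2), (R k 0 * R (k + 1) 1 - R (k + 1) 0 * R k 1)) / 2

/-- The configuration with angle coordinates `β = (β₁, …, βₙ₋₁)`: the first link has
direction `0`, the link from `r_k` to `r_{k+1}` has direction `β_k`, so that `r_k` is the sum
of the first `k` link vectors. -/
noncomputable def armConfiguration {m : ℕ} (L : Fin (m + 1) → ℝ) (β : Fin m → ℝ) :
    Fin (m + 2) → Plane := fun k =>
  ∑ i : Fin (m + 1) with i.castSucc < k,
    L i • !₂[Real.cos (Fin.cons (α := fun _ => ℝ) 0 β i),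
             Real.sin (Fin.cons (α := fun _ => ℝ) 0 β i)]

theorem armConfiguration_zero {m : ℕ} (L : Fin (m + 1) → ℝ) (β : Fin m → ℝ) :
    armConfiguration L β 0 = 0 := by
  simp [armConfiguration]

theorem armConfiguration_succ {m : ℕ} (L : Fin (m + 1) → ℝ) (β : Fin m → ℝ)
    (i : Fin (m + 1)) :
    armConfiguration L β i.succ = armConfiguration L β i.castSucc +
      L i • !₂[Real.cos (Fin.cons (α := fun _ => ℝ) 0 β i),
               Real.sin (Fin.cons (α := fun _ => ℝ) 0 β i)] := by
  have h : (Finset.univ.filter fun j : Fin (m + 1) => j.castSucc < i.succ) =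
      insert i (Finset.univ.filter fun j : Fin (m + 1) => j.castSucc < i.castSucc) := by
    ext j
    simp only [Finset.mem_filter, Finset.mem_univ, true_and, Finset.mem_insert,
      Fin.castSucc_lt_succ_iff, Fin.castSucc_lt_castSucc_iff]
    exact le_iff_eq_or_lt
  unfold armConfiguration
  rw [h, Finset.sum_insert (by simp), add_comm]

/-- The angle coordinates parametrize the whole moduli space. -/
theorem range_armConfiguration {m : ℕ} {L : Fin (m + 1) → ℝ} (hL : L ∈ lengthVectors m) :
    Set.range (armConfiguration L) = moduliSpace L := by
  ext R
  constructor
  · rintro ⟨β, rfl⟩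
    refine ⟨fun i => ?_, ?_, ?_⟩
    · rw [armConfiguration_succ, dist_self_add_right, norm_smul, EuclideanSpace.norm_eq]
      simp [abs_of_pos (hL i)]
    · rw [armConfiguration_zero]
      ext i; fin_cases i <;> simp
    · have := armConfiguration_succ L β 0
      rw [Fin.castSucc_zero, armConfiguration_zero, Fin.succ_zero_eq_one] at this
      rw [this]
      ext i; fin_cases i <;> simp
  · rintro ⟨hR, h0, h1⟩
    have key : ∀ i : Fin (m + 1), ∃ t : ℝ,
        R i.succ = R i.castSucc + L i • !₂[Real.cos t, Real.sin t] := by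
      intro i
      have hn := hR i
      rw [EuclideanSpace.dist_eq] at hn
      have hz : ‖(⟨R i.succ 0 - R i.castSucc 0, R i.succ 1 - R i.castSucc 1⟩ : ℂ)‖ = L i := by
        rw [← hn, Complex.norm_def, Complex.normSq_mk]
        congr 1
        simp only [Fin.sum_univ_two, Real.dist_eq, sq_abs]
        ring
      set z : ℂ := ⟨R i.succ 0 - R i.castSucc 0, R i.succ 1 - R i.castSucc 1⟩ with hzdef
      have e0 := Complex.norm_mul_cos_arg z
      have e1 := Complex.norm_mul_sin_arg z
      rw [hz] at e0 e1
      refine ⟨Complex.arg z, ?_⟩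
      ext j
      fin_cases j
      · have : z.re = R i.succ 0 - R i.castSucc 0 := rfl
        simp [e0, this]
      · have : z.im = R i.succ 1 - R i.castSucc 1 := rfl
        simp [e1, this]
    choose t ht using key
    refine ⟨fun i => t i.succ, ?_⟩
    funext k
    induction k using Fin.induction with
    | zero =>
      rw [armConfiguration_zero, h0]
      ext i; fin_cases i <;> simp
    | succ i ih =>
      rw [armConfiguration_succ, ih]
      induction i using Fin.cases with
      | zero =>
        rw [Fin.castSucc_zero, h0, Fin.succ_zero_eq_one, h1]
        ext i; fin_cases i <;> simp
      | succ j => rw [ht j.succ]; simp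

/-- Two angle vectors give the same configuration iff they agree modulo `2π`: the moduli space
is the torus of angle vectors modulo `2π`. -/
theorem armConfiguration_eq_iff {m : ℕ} {L : Fin (m + 1) → ℝ} (hL : L ∈ lengthVectors m)
    (β γ : Fin m → ℝ) :
    armConfiguration L β = armConfiguration L γ ↔
      ∀ k, (β k : Real.Angle) = (γ k : Real.Angle) := by
  constructor
  · intro h k
    have h1 := armConfiguration_succ L β k.succ
    rw [h, armConfiguration_succ L γ k.succ, add_right_inj] at h1
    have h2 := smul_right_injective _ (hL k.succ).ne' h1
    have c := congrFun (congrArg WithLp.ofLp h2) 0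
    have s := congrFun (congrArg WithLp.ofLp h2) 1
    simp at c s
    exact (Real.Angle.cos_sin_inj c s).symm
  · intro h
    funext k
    induction k using Fin.induction with
    | zero => rw [armConfiguration_zero, armConfiguration_zero]
    | succ i ih =>
      rw [armConfiguration_succ, armConfiguration_succ, ih]
      induction i using Fin.cases with
      | zero => simp
      | succ j =>
        have c := congrArg Real.Angle.cos (h j)
        have s := congrArg Real.Angle.sin (h j)
        simp at c s
        simp [c, s]

/-- A function `f` on configurations, restricted to `M⁰(L)` and written in angle coordinates. -/
noncomputable def inAngles {m : ℕ} (L : Fin (m + 1) → ℝ) (f : (Fin (m + 2) → Plane) → ℝ) :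
    (Fin m → ℝ) → ℝ :=
  fun β => f (armConfiguration L β)

/-- `R ∈ M⁰(L)` is a critical point of `f` on `M⁰(L)`: the differential of `f` in angle
coordinates vanishes at `R`. -/
def IsCriticalPoint {m : ℕ} (L : Fin (m + 1) → ℝ) (f : (Fin (m + 2) → Plane) → ℝ)
    (R : Fin (m + 2) → Plane) : Prop :=
  ∃ β : Fin m → ℝ, armConfiguration L β = R ∧ fderiv ℝ (inAngles L f) β = 0

/-- The Hessian of `f` on `M⁰(L)` in angle coordinates is a nondegenerate bilinear form
at `R ∈ M⁰(L)`. -/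
def HasNondegenerateHessian {m : ℕ} (L : Fin (m + 1) → ℝ) (f : (Fin (m + 2) → Plane) → ℝ)
    (R : Fin (m + 2) → Plane) : Prop :=
  ∃ β : Fin m → ℝ, armConfiguration L β = R ∧
    ∀ v : Fin m → ℝ, (∀ w : Fin m → ℝ, fderiv ℝ (fderiv ℝ (inAngles L f)) β v w = 0) → v = 0

/-- `f` is a Morse function on `M⁰(L)`: it is smooth, and every critical point is
nondegenerate. -/
def IsMorse {m : ℕ} (L : Fin (m + 1) → ℝ) (f : (Fin (m + 2) → Plane) → ℝ) : Prop :=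
  ContDiff ℝ ∞ (inAngles L f) ∧
    ∀ R ∈ moduliSpace L, IsCriticalPoint L f R → HasNondegenerateHessian L f R

/-- A property of length vectors is generic: the length vectors with this property form
an open dense subset of `ℝⁿ₊` whose complement in `ℝⁿ₊` has Lebesgue measure zero. -/
def IsGeneric {m : ℕ} (p : (Fin (m + 1) → ℝ) → Prop) : Prop :=
  IsOpen {L | L ∈ lengthVectors m ∧ p L} ∧
    lengthVectors m ⊆ closure {L | L ∈ lengthVectors m ∧ p L} ∧
    MeasureTheory.volume {L | L ∈ lengthVectors m ∧ ¬ p L} = 0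

/-! Measure vertices from the midpoint of the two end points. Turning link `k` alone changes the
area at half the rate `|u_{k+1}|² - |u_k|²`, so at a critical point all vertices lie on a circle in
which the end points are antipodal. A null vector of the Hessian is a deformation of the link
directions that preserves these equations to first order (`IsDegenerateCritical.exists_mem_image`).

Such chains are parametrized, up to rotation and a sign `ε`, by the diameter and all inscribed
angles but the last: as many parameters as lengths. A null vector of the Hessian moves these
parameters while fixing the lengths, so it gives a nonzero kernel vector of the derivative of
`inscribedLengths` (`exists_critical_inscribedLengths`). The non-Morse lengths are therefore
critical values of one of two maps between spaces of equal dimension, a null set by Sard's theorem.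

Openness comes from compactness of the torus and of the unit sphere of null directions; density
follows because nonempty open sets have positive measure. -/

theorem Fin.eq_prod_mul_of_succ_eq {M : Type*} [CommMonoid M] {n : ℕ} (u : Fin (n + 1) → M)
    (c : Fin n → M) (h : ∀ k, u k.succ = c k * u k.castSucc) :
    u (Fin.last n) = (∏ k, c k) * u 0 := by
  induction n with
  | zero => simp
  | succ n ih =>
    have h1 := ih (fun k => u k.castSucc) (fun k => c k.castSucc) fun k => h k.castSucc
    rw [← Fin.succ_last, h, h1, Fin.prod_univ_castSucc, Fin.castSucc_zero, mul_comm _ (c _),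
      mul_assoc]

/-! ### Lengths of inscribed chains and their critical values -/

/-- The link lengths of the polygonal chains inscribed in a circle whose end points are
antipodal. The last entry of `p` is the diameter of the circle, the other ones are the
inscribed angles over all links but the last; `ε = ±1` is an orientation. -/
noncomputable def inscribedLengths {m : ℕ} (ε : ℝ) (p : Fin (m + 1) → ℝ) : Fin (m + 1) → ℝ :=
  Fin.snoc (α := fun _ => ℝ) (fun k : Fin m => p (Fin.last m) * Real.sin (p k.castSucc))
    (ε * p (Fin.last m) * Real.cos (∑ k : Fin m, p k.castSucc))

theorem differentiable_inscribedLengths {m : ℕ} (ε : ℝ) :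
    Differentiable ℝ (inscribedLengths (m := m) ε) := by
  rw [differentiable_pi]
  intro i
  induction i using Fin.lastCases with
  | last => simp only [inscribedLengths, Fin.snoc_last]; fun_prop
  | cast k => simp only [inscribedLengths, Fin.snoc_castSucc]; fun_prop

/-- The hypotheses are the components of the derivative along the line `p + t • v`, the last one
without its factor `ε`. -/
theorem fderiv_inscribedLengths_eq_zero {m : ℕ} {ε : ℝ} {p v : Fin (m + 1) → ℝ}
    (h : ∀ k : Fin m, v (Fin.last m) * Real.sin (p k.castSucc)
      + p (Fin.last m) * (Real.cos (p k.castSucc) * v k.castSucc) = 0)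
    (h' : v (Fin.last m) * Real.cos (∑ k : Fin m, p k.castSucc)
      - p (Fin.last m) * (Real.sin (∑ k : Fin m, p k.castSucc) * ∑ k : Fin m, v k.castSucc) = 0) :
    fderiv ℝ (inscribedLengths ε) p v = 0 := by
  have hline : ∀ i, HasDerivAt (fun t : ℝ => (p + t • v) i) (v i) 0 := fun i => by
    simpa using ((hasDerivAt_id (0 : ℝ)).mul_const (v i)).const_add (p i)
  have hsum : HasDerivAt (fun t : ℝ => ∑ k : Fin m, (p + t • v) k.castSucc)
      (∑ k : Fin m, v k.castSucc) 0 := HasDerivAt.fun_sum fun k _ => hline k.castSucc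
  have h1 : HasDerivAt (fun t : ℝ => inscribedLengths ε (p + t • v)) 0 0 := by
    rw [hasDerivAt_pi]
    intro i
    induction i using Fin.lastCases with
    | last =>
      simp only [inscribedLengths, Fin.snoc_last]
      refine (((hline (Fin.last m)).const_mul ε).mul hsum.cos).congr_deriv ?_
      simp only [zero_smul, add_zero, Pi.zero_apply]
      linear_combination ε * h'
    | cast k =>
      simp only [inscribedLengths, Fin.snoc_castSucc]
      refine ((hline (Fin.last m)).mul (hline k.castSucc).sin).congr_deriv ?_
      simp only [zero_smul, add_zero, Pi.zero_apply]
      linear_combination h k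
  have h2 : HasDerivAt (fun t : ℝ => p + t • v) v 0 := by
    rw [hasDerivAt_pi]; exact hline
  have h3 := (differentiable_inscribedLengths ε (p + (0 : ℝ) • v)).hasFDerivAt.comp_hasDerivAt
    (0 : ℝ) h2
  simpa using h3.unique h1

/-- Sard's theorem in equal dimensions: a nonzero kernel vector makes the Jacobian determinant
vanish. -/
theorem volume_image_critical_inscribedLengths (m : ℕ) (ε : ℝ) :
    MeasureTheory.volume (inscribedLengths (m := m) ε ''
      {p | ∃ v ≠ 0, fderiv ℝ (inscribedLengths ε) p v = 0}) = 0 := by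
  refine MeasureTheory.addHaar_image_eq_zero_of_det_fderivWithin_eq_zero _
    (f' := fun p => fderiv ℝ (inscribedLengths ε) p)
    (fun p _ => (differentiable_inscribedLengths ε p).hasFDerivAt.hasFDerivWithinAt) ?_
  rintro p ⟨v, hv, h⟩
  rw [ContinuousLinearMap.det, LinearMap.det_eq_zero_iff_ker_ne_bot]
  exact fun hbot => hv (LinearMap.ker_eq_bot'.1 hbot v h)

/-! ### Infinitesimal deformations of inscribed chains -/

/-- A vertex of a chain together with the next one subtends an inscribed angle `φ`. -/
theorem exists_rotation {z w : ℂ} (hz : z ≠ 0) (h : ‖w‖ = ‖z‖) :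
    ∃ φ : ℝ, w = Complex.exp ((2 * φ : ℝ) * Complex.I) * z ∧ 0 ≤ Real.sin φ := by
  have hq : ‖w / z‖ = 1 := by rw [norm_div, h, div_self (norm_ne_zero_iff.2 hz)]
  have he := Complex.norm_mul_exp_arg_mul_I (w / z)
  rw [hq, Complex.ofReal_one, one_mul] at he
  have hw : w = Complex.exp ((w / z).arg * Complex.I) * z := by
    rw [he, div_mul_cancel₀ _ hz]
  -- `φ` is determined only modulo `π`, and adding `π` changes the sign of `sin φ`. With `sin φ ≥ 0`
  -- the chord length is the diameter times `sin φ`, without absolute value.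
  rcases le_total 0 (Real.sin ((w / z).arg / 2)) with hs | hs
  · refine ⟨(w / z).arg / 2, ?_, hs⟩
    rw [mul_div_cancel₀ _ two_ne_zero]
    exact hw
  · refine ⟨(w / z).arg / 2 + Real.pi, ?_, by rw [Real.sin_add_pi]; linarith⟩
    have : ((2 * ((w / z).arg / 2 + Real.pi) : ℝ) : ℂ) * Complex.I
        = (w / z).arg * Complex.I + 2 * Real.pi * Complex.I := by push_cast; ring
    rw [this, Complex.exp_add, Complex.exp_two_pi_mul_I, mul_one]
    exact hw

theorem Complex.exp_two_mul_I_sub_one (φ : ℝ) :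
    Complex.exp ((2 * φ : ℝ) * Complex.I) - 1
      = Complex.exp (φ * Complex.I) * (2 * Real.sin φ * Complex.I) := by
  rw [Complex.exp_ofReal_mul_I, Complex.exp_ofReal_mul_I, Real.cos_two_mul, Real.sin_two_mul]
  have h := Real.sin_sq_add_cos_sq φ
  apply Complex.ext
  · simp [-Complex.ofReal_cos, -Complex.ofReal_sin, pow_two]; linear_combination 2 * h
  · simp [-Complex.ofReal_cos, -Complex.ofReal_sin, pow_two]; ring

/-- The velocity of a chord of a circle, when the chord turns with angular velocity `θ`
and the end points move with velocities `(a + τ i) z` and `(a + τ' i) w`. -/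
theorem inscribed_velocity {z w : ℂ} {φ a τ τ' θ : ℝ} (hz : z ≠ 0) (hs : Real.sin φ ≠ 0)
    (hw : w = Complex.exp ((2 * φ : ℝ) * Complex.I) * z)
    (h : (a + τ' * Complex.I) * w - (a + τ * Complex.I) * z
      = Complex.I * θ * (w - z)) :
    2 * a * Real.sin φ + Real.cos φ * (τ' - τ) = 0 ∧ θ = (τ' + τ) / 2 := by
  have hsq := Real.sin_sq_add_cos_sq φ
  have h1 : (a + τ' * Complex.I) * Complex.exp ((2 * φ : ℝ) * Complex.I) - (a + τ * Complex.I)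
      = Complex.I * θ * (Complex.exp ((2 * φ : ℝ) * Complex.I) - 1) := by
    apply mul_right_cancel₀ hz
    rw [hw] at h
    linear_combination h
  -- Multiplying by `exp (-φ i)` makes the equation symmetric in the two end points; its imaginary
  -- and real parts are the two claims.
  have h2 : (2 * a * Real.sin φ + Real.cos φ * (τ' - τ) : ℝ) * Complex.I
      - ((τ' + τ) * Real.sin φ : ℝ) = - ((2 * θ * Real.sin φ : ℝ) : ℂ) := by
    have he : Complex.exp ((2 * φ : ℝ) * Complex.I)
        = Complex.exp (φ * Complex.I) * Complex.exp (φ * Complex.I) := by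
      rw [← Complex.exp_add]; congr 1; push_cast; ring
    have he' : Complex.exp (φ * Complex.I) * Complex.exp (-φ * Complex.I) = 1 := by
      rw [← Complex.exp_add]; simp
    have h3 : (a + τ' * Complex.I) * Complex.exp (φ * Complex.I)
        - (a + τ * Complex.I) * Complex.exp (-φ * Complex.I)
        = Complex.I * θ * (Complex.exp (φ * Complex.I) - Complex.exp (-φ * Complex.I)) := by
      rw [he] at h1
      linear_combination Complex.exp (-φ * Complex.I) * h1
        - ((a + τ' * Complex.I) - Complex.I * θ) * Complex.exp (φ * Complex.I) * he'
    have e1 : Complex.exp (φ * Complex.I) = Real.cos φ + Real.sin φ * Complex.I := by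
      rw [Complex.exp_ofReal_mul_I]
    have e2 : Complex.exp (-φ * Complex.I) = Real.cos φ - Real.sin φ * Complex.I := by
      rw [← Complex.ofReal_neg, Complex.exp_ofReal_mul_I]; simp; ring
    rw [e1, e2] at h3
    push_cast at h3 ⊢
    linear_combination h3 + (2 * θ - τ' - τ) * Complex.sin φ * Complex.I_sq
  have hre := congrArg Complex.re h2
  have him := congrArg Complex.im h2
  simp only [Complex.sub_re, Complex.sub_im, Complex.neg_re, Complex.neg_im, Complex.ofReal_re,
    Complex.ofReal_im, Complex.re_ofReal_mul, Complex.im_ofReal_mul, Complex.I_re, Complex.I_im]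
    at hre him
  refine ⟨by linarith, mul_right_cancel₀ hs (by linarith)⟩

/-- If an inscribed chain with antipodal end points has an infinitesimal deformation that keeps
the lengths of its links, keeps it inscribed to first order, and is not a rotation, then its
vector of lengths is a critical value of `inscribedLengths`. -/
theorem exists_critical_inscribedLengths {m : ℕ} {L W : Fin (m + 1) → ℝ}
    (hL : ∀ k, 0 < L k) (hW0 : W 0 = 0) (hW : W ≠ 0) {u u' : Fin (m + 2) → ℂ}
    (hlen : ∀ k : Fin (m + 1), ‖u k.succ - u k.castSucc‖ = L k)
    (hrot : ∀ k : Fin (m + 1), u' k.succ - u' k.castSucc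
      = Complex.I * W k * (u k.succ - u k.castSucc))
    (hlast : u (Fin.last _) = - u 0) (hlast' : u' (Fin.last _) = - u' 0)
    (hnorm : ∀ k : Fin (m + 1), ‖u k.succ‖ = ‖u k.castSucc‖)
    (hre : ∀ k : Fin (m + 1), (u' k.succ / u k.succ).re = (u' k.castSucc / u k.castSucc).re) :
    ∃ ε : ℝ, (ε = 1 ∨ ε = -1) ∧ L ∈ inscribedLengths (m := m) ε ''
      {p | ∃ v ≠ 0, fderiv ℝ (inscribedLengths ε) p v = 0} := by
  have hn : ∀ k, ‖u k‖ = ‖u 0‖ := fun k => by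
    induction k using Fin.induction with
    | zero => rfl
    | succ k ih => rw [hnorm, ih]
  have hr : ∀ k, (u' k / u k).re = (u' 0 / u 0).re := fun k => by
    induction k using Fin.induction with
    | zero => rfl
    | succ k ih => rw [hre, ih]
  have hu0 : u 0 ≠ 0 := fun h0 => by
    have h1 : ∀ k, u k = 0 := fun k => by simpa [h0] using hn k
    have := hlen 0
    simp only [h1, sub_zero, norm_zero] at this
    exact (hL 0).ne this
  have hu : ∀ k, u k ≠ 0 := fun k => by
    rw [← norm_ne_zero_iff, hn, norm_ne_zero_iff]; exact hu0
  choose φ hφ hsin using fun k : Fin (m + 1) => exists_rotation (hu k.castSucc) (hnorm k)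
  set D : ℝ := 2 * ‖u 0‖ with hD
  have hDpos : 0 < D := by have := norm_pos_iff.2 hu0; positivity
  have hLφ : ∀ k, L k = D * Real.sin (φ k) := fun k => by
    rw [← hlen k, hφ k, ← sub_one_mul, Complex.exp_two_mul_I_sub_one, norm_mul, norm_mul,
      Complex.norm_exp_ofReal_mul_I, hn]
    have : ‖(2 * Real.sin (φ k) * Complex.I : ℂ)‖ = 2 * Real.sin (φ k) := by
      rw [norm_mul, norm_mul, Complex.norm_I, Complex.norm_real, Real.norm_of_nonneg (hsin k)]
      simp
    rw [this]; ring
  have hsin' : ∀ k, Real.sin (φ k) ≠ 0 := fun k h => by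
    have := hLφ k
    rw [h, mul_zero] at this
    exact (hL k).ne' this
  set a : ℝ := (u' 0 / u 0).re with ha
  set τ : Fin (m + 2) → ℝ := fun k => (u' k / u k).im with hτ
  have hu' : ∀ k, u' k = (a + τ k * Complex.I) * u k := fun k => by
    rw [← hr k, Complex.re_add_im, div_mul_cancel₀ _ (hu k)]
  have hvel : ∀ k : Fin (m + 1), 2 * a * Real.sin (φ k)
      + Real.cos (φ k) * (τ k.succ - τ k.castSucc) = 0
      ∧ W k = (τ k.succ + τ k.castSucc) / 2 := fun k => by
    refine inscribed_velocity (hu k.castSucc) (hsin' k) (hφ k) ?_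
    rw [← hu', ← hu']; exact hrot k
  -- Consecutive vertices differ by the rotation through `2 φ k`, so `ψ k` is the velocity of `φ k`.
  set ψ : Fin (m + 1) → ℝ := fun k => (τ k.succ - τ k.castSucc) / 2 with hψ
  have hτlast : τ (Fin.last _) = τ 0 := by simp only [hτ, hlast, hlast', neg_div_neg_eq]
  have hψsum : (∑ k : Fin m, ψ k.castSucc) + ψ (Fin.last m) = 0 := by
    rw [← Fin.sum_univ_castSucc, hψ, ← Finset.sum_div, Finset.sum_sub_distrib]
    have h1 := Fin.sum_univ_succ τ
    have h2 := Fin.sum_univ_castSucc τ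
    rw [h1, hτlast] at h2
    have : ∑ i : Fin (m + 1), τ i.succ - ∑ i : Fin (m + 1), τ i.castSucc = 0 := by linarith
    rw [this, zero_div]
  -- The rotations through `2 φ k` carry `u 0` to `-u 0`, so the sum of all `φ k` is an odd multiple
  -- of `π / 2`. This eliminates the last angle and produces `ε`.
  have hprod := Fin.eq_prod_mul_of_succ_eq u _ hφ
  rw [← Complex.exp_sum, ← Finset.sum_mul, hlast, ← Complex.ofReal_sum, ← Finset.mul_sum,
    Fin.sum_univ_castSucc] at hprod
  set S : ℝ := ∑ k : Fin m, φ k.castSucc with hS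
  have hcos : Real.cos (S + φ (Fin.last m)) = 0 := by
    have h1 : Complex.exp ((2 * (S + φ (Fin.last m)) : ℝ) * Complex.I) = -1 :=
      mul_right_cancel₀ hu0 (by rw [← hprod]; ring)
    have h2 := congrArg Complex.re h1
    rw [Complex.exp_ofReal_mul_I_re, Real.cos_two_mul] at h2
    have h3 : Real.cos (S + φ (Fin.last m)) ^ 2 = 0 := by
      rw [Complex.neg_re, Complex.one_re] at h2; linarith
    exact pow_eq_zero_iff two_ne_zero |>.1 h3
  set ε : ℝ := Real.sin (S + φ (Fin.last m)) with hε
  have hε2 : ε = 1 ∨ ε = -1 := by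
    have := Real.sin_sq_add_cos_sq (S + φ (Fin.last m))
    rw [hcos, zero_pow two_ne_zero, add_zero] at this
    exact sq_eq_one_iff.1 this
  have hlsin : Real.sin (φ (Fin.last m)) = ε * Real.cos S := by
    have := Real.sin_sub (S + φ (Fin.last m)) S
    rw [hcos, add_sub_cancel_left] at this
    rw [this]; ring
  have hlcos : Real.cos (φ (Fin.last m)) = ε * Real.sin S := by
    have := Real.cos_sub (S + φ (Fin.last m)) S
    rw [hcos, add_sub_cancel_left] at this
    rw [this]; ring
  have hε0 : ε ≠ 0 := by rcases hε2 with h | h <;> rw [h] <;> norm_num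
  -- The radius has relative velocity `a`, so the diameter `D` has velocity `D * a`.
  refine ⟨ε, hε2, Fin.snoc (α := fun _ => ℝ) (fun k : Fin m => φ k.castSucc) D,
    ⟨Fin.snoc (α := fun _ => ℝ) (fun k : Fin m => ψ k.castSucc) (D * a), ?_, ?_⟩, ?_⟩
  · intro hv
    have h1 : D * a = 0 := by simpa using congrFun hv (Fin.last m)
    have h2 : ∀ k : Fin m, ψ k.castSucc = 0 := fun k => by simpa using congrFun hv k.castSucc
    have h3 : ∀ k, ψ k = 0 := fun k => by
      induction k using Fin.lastCases with
      | last => simpa [h2] using hψsum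
      | cast k => exact h2 k
    have h4 : ∀ k, τ k = τ 0 := fun k => by
      induction k using Fin.induction with
      | zero => rfl
      | succ k ih => have := h3 k; simp only [hψ] at this; linarith
    apply hW
    funext k
    have h5 := (hvel 0).2
    rw [hW0, h4, h4 (Fin.castSucc 0)] at h5
    rw [(hvel k).2, h4, h4 k.castSucc, ← h5, Pi.zero_apply]
  · apply fderiv_inscribedLengths_eq_zero
    · intro k
      simp only [Fin.snoc_last, Fin.snoc_castSucc, hψ]
      linear_combination D / 2 * (hvel k.castSucc).1
    · simp only [Fin.snoc_last, Fin.snoc_castSucc, ← hS]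
      have h1 := (hvel (Fin.last m)).1
      have h2 : τ (Fin.last m).succ - τ (Fin.last m).castSucc = 2 * ψ (Fin.last m) := by
        simp only [hψ]; ring
      rw [h2, hlsin, hlcos] at h1
      apply mul_left_cancel₀ hε0
      linear_combination D / 2 * h1 - D * ε * Real.sin S * hψsum
  · funext k
    induction k using Fin.lastCases with
    | last =>
      simp only [inscribedLengths, Fin.snoc_last, Fin.snoc_castSucc, ← hS]
      rw [hLφ, hlsin]; ring
    | cast k => simp only [inscribedLengths, Fin.snoc_last, Fin.snoc_castSucc]; rw [hLφ]

/-! ### The area as a sum of sines of angle differences -/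

section SumSin
variable {ι E : Type*} [Fintype ι] [NormedAddCommGroup E] [NormedSpace ℝ E]

theorem contDiff_sum_mul_sin (c : ι → ℝ) (l : ι → E →L[ℝ] ℝ) :
    ContDiff ℝ ∞ fun x => ∑ a, c a * Real.sin (l a x) := by
  fun_prop

theorem fderiv_sum_mul_sin (c : ι → ℝ) (l : ι → E →L[ℝ] ℝ) :
    fderiv ℝ (fun x => ∑ a, c a * Real.sin (l a x))
      = fun x => ∑ a, (c a * Real.cos (l a x)) • l a := by
  funext x
  refine HasFDerivAt.fderiv (HasFDerivAt.fun_sum fun a _ => ?_)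
  simpa [smul_smul] using ((l a).hasFDerivAt (x := x)).sin.const_mul (c a)

theorem fderiv_fderiv_sum_mul_sin_apply (c : ι → ℝ) (l : ι → E →L[ℝ] ℝ) (x v w : E) :
    fderiv ℝ (fderiv ℝ (fun x => ∑ a, c a * Real.sin (l a x))) x v w
      = -∑ a, c a * Real.sin (l a x) * l a v * l a w := by
  rw [fderiv_sum_mul_sin]
  have h : HasFDerivAt (fun x => ∑ a, (c a * Real.cos (l a x)) • l a)
      (∑ a, ((c a • (-Real.sin (l a x)) • l a).smulRight (l a))) x :=
    HasFDerivAt.fun_sum fun a _ =>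
      (((l a).hasFDerivAt (x := x)).cos.const_mul (c a)).smul_const (l a)
  rw [h.fderiv]
  simp only [sum_apply, ContinuousLinearMap.smulRight_apply,
    smul_apply, smul_eq_mul, ← Finset.sum_neg_distrib]
  exact Finset.sum_congr rfl fun a _ => by ring

end SumSin

/-- The directions of the links of a robot arm, as linear functions of the angle coordinates. -/
noncomputable def linkAngle {m : ℕ} (i : Fin (m + 1)) : (Fin m → ℝ) →L[ℝ] ℝ :=
  Fin.cases (motive := fun _ => (Fin m → ℝ) →L[ℝ] ℝ) 0 (fun k => ContinuousLinearMap.proj k) i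

theorem linkAngle_apply {m : ℕ} (i : Fin (m + 1)) (β : Fin m → ℝ) :
    linkAngle i β = Fin.cons (α := fun _ => ℝ) 0 β i := by
  induction i using Fin.cases <;> simp [linkAngle]

/-- The coefficient of `sin (β_j - β_i)` in the oriented area. -/
noncomputable def areaCoeff {m : ℕ} (L : Fin (m + 1) → ℝ) (a : Fin (m + 1) × Fin (m + 1)) : ℝ :=
  if a.1 < a.2 then L a.1 * L a.2 / 2 else 0

/-- The closing term vanishes because `r₀ = 0`, and `r_k × r_{k+1}` is the sum of the cross products
of the earlier links with link `k`. -/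
theorem inAngles_orientedArea {m : ℕ} (L : Fin (m + 1) → ℝ) :
    inAngles L orientedArea = fun β : Fin m → ℝ =>
      ∑ a, areaCoeff L a * Real.sin ((linkAngle a.2 - linkAngle a.1) β) := by
  funext β
  have h0 : ∀ (k : Fin (m + 2)), armConfiguration L β k 0
      = ∑ i : Fin (m + 1), if i.castSucc < k then L i * Real.cos (linkAngle i β) else 0 := by
    intro k
    simp only [armConfiguration, Finset.sum_filter, linkAngle_apply, WithLp.ofLp_sum,
      Finset.sum_apply]
    refine Finset.sum_congr rfl fun i _ => ?_
    split_ifs <;> simp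
  have h1 : ∀ (k : Fin (m + 2)), armConfiguration L β k 1
      = ∑ i : Fin (m + 1), if i.castSucc < k then L i * Real.sin (linkAngle i β) else 0 := by
    intro k
    simp only [armConfiguration, Finset.sum_filter, linkAngle_apply, WithLp.ofLp_sum,
      Finset.sum_apply]
    refine Finset.sum_congr rfl fun i _ => ?_
    split_ifs <;> simp
  have hs : ∀ i : Fin (m + 1), i.castSucc + 1 = i.succ := fun i => by simp
  rw [inAngles, orientedArea, Fin.sum_univ_castSucc]
  have hz : armConfiguration L β (Fin.last (m + 1) + 1) = 0 := by
    rw [Fin.last_add_one, armConfiguration_zero]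
  rw [hz, Fintype.sum_prod_type_right]
  simp only [PiLp.zero_apply, mul_zero, zero_mul, sub_zero, add_zero]
  rw [Finset.sum_div]
  refine Finset.sum_congr rfl fun k _ => ?_
  rw [hs, armConfiguration_succ]
  simp only [PiLp.add_apply, PiLp.smul_apply, ← linkAngle_apply, smul_eq_mul,
    Matrix.cons_val_zero, Matrix.cons_val_one]
  have h2 : ∀ x y c s : ℝ, (x * (y + L k * s) - (x + L k * c) * y) / 2
      = x * (L k * s / 2) - y * (L k * c / 2) := fun x y c s => by ring
  rw [h2, h0, h1, Finset.sum_mul, Finset.sum_mul, ← Finset.sum_sub_distrib]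
  refine Finset.sum_congr rfl fun i _ => ?_
  simp only [areaCoeff, Fin.castSucc_lt_castSucc_iff]
  split_ifs
  · rw [sub_apply, Real.sin_sub]; ring
  · ring

/-! ### Degenerate critical points and openness -/

/-- Criticality of the oriented area at `β` together with degeneracy of the Hessian in
direction `w`, written out. -/
def IsDegenerateCritical {m : ℕ} (L : Fin (m + 1) → ℝ) (β w : Fin m → ℝ) : Prop :=
  (∀ v : Fin m → ℝ, ∑ a, areaCoeff L a * Real.cos ((linkAngle a.2 - linkAngle a.1) β)
    * (linkAngle a.2 - linkAngle a.1) v = 0) ∧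
  ∀ v : Fin m → ℝ, ∑ a, areaCoeff L a * Real.sin ((linkAngle a.2 - linkAngle a.1) β)
    * (linkAngle a.2 - linkAngle a.1) w * (linkAngle a.2 - linkAngle a.1) v = 0

theorem isDegenerateCritical_iff {m : ℕ} {L : Fin (m + 1) → ℝ} {β w : Fin m → ℝ} :
    IsDegenerateCritical L β w ↔ fderiv ℝ (inAngles L orientedArea) β = 0 ∧
      ∀ v, fderiv ℝ (fderiv ℝ (inAngles L orientedArea)) β w v = 0 := by
  simp only [inAngles_orientedArea, fderiv_fderiv_sum_mul_sin_apply, neg_eq_zero]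
  rw [fderiv_sum_mul_sin]
  simp only [IsDegenerateCritical, ContinuousLinearMap.ext_iff, sum_apply,
    smul_apply, smul_eq_mul, zero_apply]

theorem continuous_areaCoeff {m : ℕ} (a : Fin (m + 1) × Fin (m + 1)) :
    Continuous fun L => areaCoeff L a := by
  unfold areaCoeff
  split_ifs <;> fun_prop

theorem isClosed_isDegenerateCritical (m : ℕ) :
    IsClosed {x : (Fin (m + 1) → ℝ) × (Fin m → ℝ) × (Fin m → ℝ) |
      IsDegenerateCritical x.1 x.2.1 x.2.2} := by
  have h' : ∀ a, Continuous fun x : (Fin (m + 1) → ℝ) × (Fin m → ℝ) × (Fin m → ℝ) =>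
    areaCoeff x.1 a := fun a => (continuous_areaCoeff a).comp continuous_fst
  simp only [IsDegenerateCritical, Set.ofPred_and, Set.ofPred_forall]
  refine IsClosed.inter ?_ ?_ <;> refine isClosed_iInter fun v => ?_ <;>
    exact isClosed_eq (by fun_prop) continuous_const

theorem angle_linkAngle_eq {m : ℕ} {β γ : Fin m → ℝ}
    (h : ∀ k, (β k : Real.Angle) = (γ k : Real.Angle)) (a : Fin (m + 1) × Fin (m + 1)) :
    (((linkAngle a.2 - linkAngle a.1) β : ℝ) : Real.Angle)
      = ((linkAngle a.2 - linkAngle a.1) γ : ℝ) := by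
  have h1 : ∀ i : Fin (m + 1), ((linkAngle i β : ℝ) : Real.Angle) = (linkAngle i γ : ℝ) := by
    intro i
    rw [linkAngle_apply, linkAngle_apply]
    induction i using Fin.cases with
    | zero => rfl
    | succ k => exact h k
  rw [sub_apply, sub_apply, Real.Angle.coe_sub, Real.Angle.coe_sub, h1, h1]

theorem IsDegenerateCritical.of_angle_eq {m : ℕ} {L : Fin (m + 1) → ℝ} {β γ w : Fin m → ℝ}
    (hd : IsDegenerateCritical L β w) (h : ∀ k, (β k : Real.Angle) = (γ k : Real.Angle)) :
    IsDegenerateCritical L γ w := by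
  have hc : ∀ a : Fin (m + 1) × Fin (m + 1), Real.cos ((linkAngle a.2 - linkAngle a.1) γ)
      = Real.cos ((linkAngle a.2 - linkAngle a.1) β) := fun a => by
    rw [← Real.Angle.cos_coe, ← angle_linkAngle_eq h, Real.Angle.cos_coe]
  have hs : ∀ a : Fin (m + 1) × Fin (m + 1), Real.sin ((linkAngle a.2 - linkAngle a.1) γ)
      = Real.sin ((linkAngle a.2 - linkAngle a.1) β) := fun a => by
    rw [← Real.Angle.sin_coe, ← angle_linkAngle_eq h, Real.Angle.sin_coe]
  simpa only [IsDegenerateCritical, hc, hs] using hd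

theorem IsDegenerateCritical.smul {m : ℕ} {L : Fin (m + 1) → ℝ} {β w : Fin m → ℝ}
    (hd : IsDegenerateCritical L β w) (c : ℝ) : IsDegenerateCritical L β (c • w) := by
  rw [isDegenerateCritical_iff] at hd ⊢
  exact ⟨hd.1, fun v => by simp [hd.2 v]⟩

/-- The oriented area is not a Morse function iff there is a degenerate critical point; the
angles and the null direction of the Hessian may be taken from compact sets. -/
theorem not_isMorse_orientedArea_iff {m : ℕ} {L : Fin (m + 1) → ℝ} (hL : L ∈ lengthVectors m) :
    ¬ IsMorse L orientedArea ↔ ∃ y ∈ (Set.Icc (fun _ => 0) (fun _ => 2 * Real.pi) ×ˢ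
      Metric.sphere 0 1 : Set ((Fin m → ℝ) × (Fin m → ℝ))), IsDegenerateCritical L y.1 y.2 := by
  constructor
  · intro h
    have hsm : ContDiff ℝ ∞ (inAngles L orientedArea) := by
      rw [inAngles_orientedArea]; exact contDiff_sum_mul_sin _ _
    rw [IsMorse, not_and] at h
    have h1 := h hsm
    push Not at h1
    obtain ⟨R, -, ⟨β, hβ, hc⟩, hn⟩ := h1
    rw [HasNondegenerateHessian] at hn
    push Not at hn
    obtain ⟨w, hw, hw0⟩ := hn β hβ
    have hd : IsDegenerateCritical L β w := isDegenerateCritical_iff.2 ⟨hc, hw⟩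
    refine ⟨(fun k => toIcoMod Real.two_pi_pos 0 (β k), ‖w‖⁻¹ • w), ⟨⟨?_, ?_⟩, ?_⟩, ?_⟩
    · intro k; exact (toIcoMod_mem_Ico' Real.two_pi_pos (β k)).1
    · intro k; exact (toIcoMod_mem_Ico' Real.two_pi_pos (β k)).2.le
    · simp [norm_smul, hw0]
    · exact (hd.smul _).of_angle_eq fun k => (Real.Angle.coe_toIcoMod _ _).symm
  · rintro ⟨⟨β, w⟩, ⟨-, hw⟩, hd⟩ ⟨-, h⟩
    -- The Morse property gives nondegeneracy at some representative `γ` of the configuration; it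
    -- agrees with `β` modulo `2π`, so degeneracy carries over.
    obtain ⟨γ, hγ, hγ'⟩ := h (armConfiguration L β)
      (by rw [← range_armConfiguration hL]; exact ⟨β, rfl⟩)
      ⟨β, rfl, (isDegenerateCritical_iff.1 hd).1⟩
    have hd' := hd.of_angle_eq ((armConfiguration_eq_iff hL β γ).1 hγ.symm)
    have hw0 := hγ' w (isDegenerateCritical_iff.1 hd').2
    simp [hw0] at hw

theorem isOpen_lengthVectors (m : ℕ) : IsOpen (lengthVectors m) := by
  simp only [lengthVectors, Set.ofPred_forall]
  exact isOpen_iInter_of_finite fun i => isOpen_lt continuous_const (continuous_apply i)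

/-- Degeneracy is a closed condition on lengths, angles and direction jointly, and projection along
the compact `K` is a closed map. -/
theorem isOpen_setOf_isMorse_orientedArea (m : ℕ) :
    IsOpen {L | L ∈ lengthVectors m ∧ IsMorse L orientedArea} := by
  set K : Set ((Fin m → ℝ) × (Fin m → ℝ)) :=
    Set.Icc (fun _ => 0) (fun _ => 2 * Real.pi) ×ˢ Metric.sphere 0 1 with hKdef
  have hK : IsCompact K := isCompact_Icc.prod (isCompact_sphere 0 1)
  have hclosed : IsClosed {L : Fin (m + 1) → ℝ | ∃ y ∈ K, IsDegenerateCritical L y.1 y.2} := by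
    have := isCompact_iff_compactSpace.1 hK
    have h1 := isClosedMap_fst_of_compactSpace (X := Fin (m + 1) → ℝ) (Y := K) _
      ((isClosed_isDegenerateCritical m).preimage
        (continuous_fst.prodMk (continuous_subtype_val.comp continuous_snd)))
    convert h1 using 1
    ext L
    constructor
    · rintro ⟨y, hy, h⟩; exact ⟨(L, ⟨y, hy⟩), h, rfl⟩
    · rintro ⟨⟨_, y⟩, h, rfl⟩; exact ⟨y, y.2, h⟩
  convert (isOpen_lengthVectors m).inter hclosed.isOpen_compl using 1
  ext L
  refine and_congr_right fun hL => ?_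
  rw [← not_not (a := IsMorse L orientedArea), not_isMorse_orientedArea_iff hL]
  rfl

/-! ### From degenerate critical points to inscribed chains -/

/-- The sign of `j - i`. -/
def orderSign {n : ℕ} (i j : Fin n) : ℝ := if i < j then 1 else if j < i then -1 else 0

/-- Link 0 cannot turn, but only angle differences matter: all other links turn backwards instead.
-/
theorem exists_linkAngle_sub_eq {m : ℕ} (k : Fin (m + 1)) :
    ∃ v : Fin m → ℝ, ∀ i j : Fin (m + 1), (linkAngle j - linkAngle i) v
      = (if j = k then 1 else 0) - (if i = k then 1 else 0) := by
  induction k using Fin.cases with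
  | zero =>
    refine ⟨fun _ => -1, fun i j => ?_⟩
    rw [sub_apply, linkAngle_apply, linkAngle_apply]
    induction i using Fin.cases <;> induction j using Fin.cases <;> simp
  | succ k =>
    refine ⟨Pi.single k 1, fun i j => ?_⟩
    rw [sub_apply, linkAngle_apply, linkAngle_apply]
    have h : ∀ i : Fin (m + 1), Fin.cons (α := fun _ => ℝ) 0 (Pi.single k (1 : ℝ)) i
        = if i = k.succ then 1 else 0 := fun i => by
      induction i using Fin.cases with
      | zero => simp [(Fin.succ_ne_zero k).symm]
      | succ i => simp [Pi.single_apply]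
    rw [h, h]

/-- Testing with the vector that turns link `k` alone leaves the pairs containing `k`, with opposite
signs on its two sides. It serves both the gradient and the Hessian equation. -/
theorem sum_orderSign_mul_eq_zero {m : ℕ} {L : Fin (m + 1) → ℝ} (hL : ∀ i, 0 < L i)
    {f : Fin (m + 1) → Fin (m + 1) → ℝ} (hf : ∀ i j, f i j = f j i)
    (h : ∀ v, ∑ a : Fin (m + 1) × Fin (m + 1),
      areaCoeff L a * f a.1 a.2 * (linkAngle a.2 - linkAngle a.1) v = 0) (k : Fin (m + 1)) :
    ∑ i, orderSign i k * L i * f i k = 0 := by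
  obtain ⟨v, hv⟩ := exists_linkAngle_sub_eq k
  have h1 := h v
  simp only [hv, mul_sub, mul_ite, mul_one, mul_zero, Finset.sum_sub_distrib] at h1
  rw [Fintype.sum_prod_type, Fintype.sum_prod_type_right] at h1
  simp only [Finset.sum_ite_eq', Finset.mem_univ, if_true] at h1
  rw [← Finset.sum_sub_distrib] at h1
  refine mul_left_cancel₀ (half_pos (hL k)).ne' ?_
  rw [mul_zero, ← h1, Finset.mul_sum]
  refine Finset.sum_congr rfl fun i _ => ?_
  rw [hf k i]
  simp only [areaCoeff, orderSign]
  rcases lt_trichotomy i k with hik | rfl | hik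
  · simp only [hik, hik.not_gt, if_true, if_false]; ring
  · simp
  · simp only [hik, hik.not_gt, if_true, if_false]; ring

/-- The vertices of the chain with links `z`, seen from the midpoint of its end points. -/
noncomputable def centeredVertex {m : ℕ} (z : Fin (m + 1) → ℂ) (k : Fin (m + 2)) : ℂ :=
  (∑ i : Fin (m + 1), if i.castSucc < k then z i else -z i) / 2

theorem centeredVertex_last {m : ℕ} (z : Fin (m + 1) → ℂ) :
    centeredVertex z (Fin.last _) = -centeredVertex z 0 := by
  simp [centeredVertex, Fin.castSucc_lt_last, neg_div]

theorem centeredVertex_succ_sub {m : ℕ} (z : Fin (m + 1) → ℂ) (k : Fin (m + 1)) :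
    centeredVertex z k.succ - centeredVertex z k.castSucc = z k := by
  rw [centeredVertex, centeredVertex, ← sub_div, ← Finset.sum_sub_distrib,
    Finset.sum_eq_single k]
  · simp
  · intro i _ hik
    rcases lt_or_gt_of_ne hik with h | h
    · simp [h, h.le, Fin.castSucc_lt_succ_iff]
    · simp [h.not_ge, h.not_gt, Fin.castSucc_lt_succ_iff]
  · simp

/-- Paired with the difference `z k`, this sum gives `|u_{k+1}|² - |u_k|²` in terms of the links,
which is how the gradient equation enters. -/
theorem centeredVertex_succ_add {m : ℕ} (z : Fin (m + 1) → ℂ) (k : Fin (m + 1)) :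
    centeredVertex z k.succ + centeredVertex z k.castSucc = ∑ i, orderSign i k * z i := by
  rw [centeredVertex, centeredVertex, ← add_div, ← Finset.sum_add_distrib, Finset.sum_div]
  refine Finset.sum_congr rfl fun i _ => ?_
  simp only [orderSign, Fin.castSucc_lt_succ_iff, Fin.castSucc_lt_castSucc_iff]
  rcases lt_trichotomy i k with h | rfl | h
  · simp [h, h.le]
  · simp
  · simp [h, h.not_ge, h.not_gt]

theorem IsDegenerateCritical.exists_mem_image {m : ℕ} {L : Fin (m + 1) → ℝ}
    (hL : L ∈ lengthVectors m) {β w : Fin m → ℝ} (hw : w ≠ 0)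
    (hd : IsDegenerateCritical L β w) :
    ∃ ε : ℝ, (ε = 1 ∨ ε = -1) ∧ L ∈ inscribedLengths (m := m) ε ''
      {p | ∃ v ≠ 0, fderiv ℝ (inscribedLengths ε) p v = 0} := by
  set b : Fin (m + 1) → ℝ := fun i => linkAngle i β with hb
  set W : Fin (m + 1) → ℝ := fun i => linkAngle i w with hW
  have hg : ∀ k, ∑ i, orderSign i k * L i * Real.cos (b k - b i) = 0 :=
    sum_orderSign_mul_eq_zero hL (f := fun i k => Real.cos (b k - b i))
      (fun i j => by rw [← Real.cos_neg, neg_sub]) hd.1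
  have hH : ∀ k, ∑ i, orderSign i k * L i * (Real.sin (b k - b i) * (W k - W i)) = 0 :=
    sum_orderSign_mul_eq_zero hL (f := fun i k => Real.sin (b k - b i) * (W k - W i))
      (fun i j => by rw [← neg_sub (b i), Real.sin_neg]; ring)
      (fun v => by simpa only [mul_assoc, sub_apply, hb, hW] using hd.2 v)
  set z : Fin (m + 1) → ℂ := fun i => ⟨L i * Real.cos (b i), L i * Real.sin (b i)⟩ with hz
  -- `z' i = W i * I * z i` is the velocity of link `i` turning with angular velocity `W i`.
  set z' : Fin (m + 1) → ℂ := fun i => ⟨-(W i * L i * Real.sin (b i)), W i * L i * Real.cos (b i)⟩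
    with hz'
  set u := centeredVertex z with hu
  set u' := centeredVertex z' with hu'
  have hnorm : ∀ k : Fin (m + 1), Complex.normSq (u k.succ) = Complex.normSq (u k.castSucc) := by
    intro k
    have h1 := centeredVertex_succ_sub z k
    have h2 := centeredVertex_succ_add z k
    rw [← hu] at h1 h2
    have r1 := congrArg Complex.re h1
    have i1 := congrArg Complex.im h1
    have r2 := congrArg Complex.re h2
    have i2 := congrArg Complex.im h2
    simp only [Complex.sub_re, Complex.sub_im, Complex.add_re, Complex.add_im, Complex.re_sum,
      Complex.im_sum, Complex.re_ofReal_mul, Complex.im_ofReal_mul] at r1 i1 r2 i2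
    have e : (z k).re * (∑ i, orderSign i k * (z i).re) + (z k).im * (∑ i, orderSign i k * (z i).im)
        = L k * ∑ i, orderSign i k * L i * Real.cos (b k - b i) := by
      rw [Finset.mul_sum, Finset.mul_sum, Finset.mul_sum, ← Finset.sum_add_distrib]
      refine Finset.sum_congr rfl fun i _ => ?_
      rw [Real.cos_sub]; simp only [hz]; ring
    rw [hg, mul_zero, ← r1, ← i1, ← r2, ← i2] at e
    rw [Complex.normSq_apply, Complex.normSq_apply]
    linarith
  have hre : ∀ k : Fin (m + 1), (u' k.succ).re * (u k.succ).re + (u' k.succ).im * (u k.succ).im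
      = (u' k.castSucc).re * (u k.castSucc).re + (u' k.castSucc).im * (u k.castSucc).im := by
    intro k
    have h1 := centeredVertex_succ_sub z k
    have h2 := centeredVertex_succ_add z k
    have h3 := centeredVertex_succ_sub z' k
    have h4 := centeredVertex_succ_add z' k
    rw [← hu] at h1 h2
    rw [← hu'] at h3 h4
    have r1 := congrArg Complex.re h1
    have i1 := congrArg Complex.im h1
    have r2 := congrArg Complex.re h2
    have i2 := congrArg Complex.im h2
    have r3 := congrArg Complex.re h3
    have i3 := congrArg Complex.im h3
    have r4 := congrArg Complex.re h4
    have i4 := congrArg Complex.im h4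
    simp only [Complex.sub_re, Complex.sub_im, Complex.add_re, Complex.add_im, Complex.re_sum,
      Complex.im_sum, Complex.re_ofReal_mul, Complex.im_ofReal_mul]
      at r1 i1 r2 i2 r3 i3 r4 i4
    -- The derivative along `W` of the corresponding identity for `|u_{k+1}|² - |u_k|²`; the right
    -- side vanishes by the Hessian equation.
    have e : (z k).re * (∑ i, orderSign i k * (z' i).re) + (z k).im * (∑ i, orderSign i k * (z' i).im)
        + ((z' k).re * (∑ i, orderSign i k * (z i).re) + (z' k).im * (∑ i, orderSign i k * (z i).im))
        = -L k * ∑ i, orderSign i k * L i * (Real.sin (b k - b i) * (W k - W i)) := by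
      simp only [Finset.mul_sum, ← Finset.sum_add_distrib]
      refine Finset.sum_congr rfl fun i _ => ?_
      rw [Real.sin_sub]; simp only [hz, hz']; ring
    rw [hH, mul_zero, ← r1, ← i1, ← r2, ← i2, ← r3, ← i3, ← r4, ← i4] at e
    linarith
  refine exists_critical_inscribedLengths hL (W := W) (u := u) (u' := u') ?_ ?_ ?_ ?_
    (centeredVertex_last z) (centeredVertex_last z') ?_ ?_
  · simp [hW, linkAngle_apply]
  · intro h0
    apply hw
    funext k
    have := congrFun h0 k.succ
    simpa [hW, linkAngle_apply] using this
  · intro k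
    rw [hu, centeredVertex_succ_sub, Complex.norm_def, Complex.normSq_mk,
      show L k * Real.cos (b k) * (L k * Real.cos (b k)) + L k * Real.sin (b k)
        * (L k * Real.sin (b k)) = L k ^ 2 by
      linear_combination L k ^ 2 * Real.sin_sq_add_cos_sq (b k), Real.sqrt_sq (hL k).le]
  · intro k
    rw [hu, hu', centeredVertex_succ_sub, centeredVertex_succ_sub]
    apply Complex.ext <;> simp [hz, hz'] <;> ring
  · intro k
    rw [Complex.norm_def, Complex.norm_def, hnorm]
  · intro k
    rw [Complex.div_re, Complex.div_re, hnorm, ← add_div, ← add_div, hre]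

/-! ### Measure zero and genericity -/

theorem volume_setOf_not_isMorse_orientedArea (m : ℕ) :
    MeasureTheory.volume {L : Fin (m + 1) → ℝ | L ∈ lengthVectors m ∧
      ¬ IsMorse L orientedArea} = 0 := by
  refine MeasureTheory.measure_mono_null ?_ (MeasureTheory.measure_union_null
    (volume_image_critical_inscribedLengths m 1) (volume_image_critical_inscribedLengths m (-1)))
  rintro L ⟨hL, h⟩
  obtain ⟨y, ⟨-, hy⟩, hd⟩ := (not_isMorse_orientedArea_iff hL).1 h
  have hw : y.2 ≠ 0 := fun h0 => by simp [h0] at hy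
  obtain ⟨ε, rfl | rfl, hε⟩ := hd.exists_mem_image hL hw
  · exact Or.inl hε
  · exact Or.inr hε

theorem theorem3 (m : ℕ) :
    IsGeneric (fun L : Fin (m + 1) → ℝ => IsMorse L orientedArea) := by
  have hnull := volume_setOf_not_isMorse_orientedArea m
  refine ⟨isOpen_setOf_isMorse_orientedArea m, fun L hL => ?_, hnull⟩
  rw [mem_closure_iff]
  intro U hU hLU
  by_contra hne
  rw [Set.not_nonempty_iff_eq_empty] at hne
  -- A neighbourhood without Morse lengths would be a nonempty open set inside a null set.
  have hsub : U ∩ lengthVectors m ⊆ {L | L ∈ lengthVectors m ∧ ¬ IsMorse L orientedArea} :=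
    fun x hx => ⟨hx.2, fun hM => (Set.eq_empty_iff_forall_notMem.1 hne) x ⟨hx.1, hx.2, hM⟩⟩
  exact ((hU.inter (isOpen_lengthVectors m)).measure_pos MeasureTheory.volume ⟨L, hLU, hL⟩).ne'
    (MeasureTheory.measure_mono_null hsub hnull)
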